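/- Let $k$ be a principal ideal domain, let $n,m\ge 2$ be integers, and let $E\in GL_n(k)$, $F\in GL_m(k)$. Let $\mathcal B(E,F)$ be the $k$-algebra generated by the entries of an $n\times m$ matrix $z=(z_{ij})$ subject to the relations $F^{-1}z^tEz=I_m$ and $zF^{-1}z^tE=I_n$. Let $\mathcal B(E)=\mathcal B(E,E)$, with generators written $a_{ij}$; it is a Hopf algebra with $\Delta(a_{ij})=\sum_{l}a_{il}\otimes a_{lj}$, $\varepsilon(a_{ij})=\delta_{ij}$ and antipode $S(a)=E^{-1}a^tE$. The algebra $\mathcal B(E,F)$ is a left $\mathcal B(E)$-comodule algebra through the algebra map $\delta(z_{ij})=\sum_{l}a_{il}\otimes z_{lj}$. For a Hopf algebra $H$ over $k$, a left $H$-Galois object is a left $H$-comodule algebra $Z$ with coaction $\delta$ that is faithfully flat over $k$, that contains $k$ as a subalgebra equal to the subalgebra of coinvariants $\{z\in Z\mid\delta(z)=1\otimes z\}$, and for which the map $Z\otimes_k Z\to H\otimes_k Z$, $z\otimes z'\mapsto\delta(z)(1\otimes z')$, is bijective. It is cleft if it is isomorphic, as an $H$-comodule algebra, to $H_\sigma$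 for some convolution-invertible bilinear map $\sigma:H\times H\to k$ satisfying $\sigma(x_{(1)}y_{(1)},z)\,\sigma(x_{(2)},y_{(2)})=\sigma(x,y_{(1)}z_{(1)})\,\sigma(y_{(2)},z_{(2)})$ and $\sigma(1,x)=\sigma(x,1)=\varepsilon(x)$ for all $x,y,z\in H$; here $H_\sigma$ is the left $H$-comodule $H$ with the product $x\cdot_\sigma y=x_{(1)}y_{(1)}\,\sigma(x_{(2)},y_{(2)})$. If $\mathcal B(E,F)$ is a cleft left $\mathcal B(E)$-Galois object, then $m=n$. -/

import Mathlib

open TensorProduct Matrix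

noncomputable section

namespace HopfGalois

open Coalgebra

/-! ### Comodule algebras and Galois objects -/

/-- A left `H`-comodule algebra: an algebra `Z` with a coassociative and counital coaction
`Z → H ⊗ Z` that is a map of algebras. -/
class LeftComoduleAlgebra (k H Z : Type*) [CommRing k] [Ring H] [HopfAlgebra k H]
    [Ring Z] [Algebra k Z] where
  /-- The coaction `Z → H ⊗ Z`. -/
  coaction : Z →ₐ[k] H ⊗[k] Z
  /-- `(Δ ⊗ id) ∘ δ = (id ⊗ δ) ∘ δ`. -/
  coassoc : (TensorProduct.assoc k H H Z).toLinearMap ∘ₗ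
      (comul : H →ₗ[k] H ⊗[k] H).rTensor Z ∘ₗ coaction.toLinearMap =
    coaction.toLinearMap.lTensor H ∘ₗ coaction.toLinearMap
  /-- `(ε ⊗ id) ∘ δ = id`, where `k ⊗ Z` is identified with `Z`. -/
  counital : (counit : H →ₗ[k] k).rTensor Z ∘ₗ coaction.toLinearMap = TensorProduct.mk k k Z 1

section Galois

variable (k H Z : Type*) [CommRing k] [Ring H] [HopfAlgebra k H] [Ring Z] [Algebra k Z]
  [LeftComoduleAlgebra k H Z]

/-- The coaction `δ : Z → H ⊗ Z`. -/
def coaction : Z →ₐ[k] H ⊗[k] Z := LeftComoduleAlgebra.coaction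

/-- The subalgebra of coinvariants `{z ∈ Z | δ z = 1 ⊗ z}`. -/
def coinvariants : Subalgebra k Z :=
  AlgHom.equalizer (coaction k H Z) Algebra.TensorProduct.includeRight

/-- The canonical map `Z ⊗ Z → H ⊗ Z`, `z ⊗ z' ↦ δ(z) (1 ⊗ z')`, over the base ring `k`. -/
def canonicalMap : Z ⊗[k] Z →ₗ[k] H ⊗[k] Z :=
  LinearMap.mul' k (H ⊗[k] Z) ∘ₗ TensorProduct.map (coaction k H Z).toLinearMap
    (Algebra.TensorProduct.includeRight : Z →ₐ[k] H ⊗[k] Z).toLinearMap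

/-- `Z` is an `H`-Galois extension of `k`: `k` is a subalgebra of `Z`, it is the subalgebra of
coinvariants, and the canonical map is bijective. -/
structure IsGaloisExtension : Prop where
  algebraMap_injective : Function.Injective (algebraMap k Z)
  coinvariants_eq : coinvariants k H Z = ⊥
  canonicalMap_bijective : Function.Bijective (canonicalMap k H Z)

/-- An `H`-Galois object is an `H`-Galois extension of `k` that is faithfully flat over `k`. -/
structure IsGaloisObject : Prop extends IsGaloisExtension k H Z where
  faithfullyFlat : Module.FaithfullyFlat k Z

end Galois

/-- `Z` and `Z'` are isomorphic as `H`-comodule algebras. -/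
def ComoduleAlgebraIso (k H Z Z' : Type*) [CommRing k] [Ring H] [HopfAlgebra k H]
    [Ring Z] [Algebra k Z] [LeftComoduleAlgebra k H Z]
    [Ring Z'] [Algebra k Z'] [LeftComoduleAlgebra k H Z'] : Prop :=
  ∃ φ : Z ≃ₐ[k] Z', ∀ z : Z,
    coaction k H Z' (φ z) = (φ.toLinearMap.lTensor H) (coaction k H Z z)

/-! ### Cocycles and twisted algebras -/

/-- A right invertible cocycle on `H`. A bilinear map `σ : H × H → k` is given as a linear map on
`H ⊗ H`; sums in Sweedler notation are written with a chosen presentation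
`Δ x = ∑ x₍₁₎ ⊗ x₍₂₎`, on which they do not depend. -/
structure RightCocycle (k H : Type*) [CommRing k] [Ring H] [HopfAlgebra k H] where
  /-- The bilinear map `σ`. -/
  toFun : H ⊗[k] H →ₗ[k] k
  /-- `σ` is invertible for the convolution product of linear maps on the coalgebra `H ⊗ H`. -/
  convInvertible : IsUnit (WithConv.toConv toFun)
  /-- `σ(x₍₁₎ y₍₁₎, z) σ(x₍₂₎, y₍₂₎) = σ(x, y₍₁₎ z₍₁₎) σ(y₍₂₎, z₍₂₎)`. -/
  cocycle : ∀ x y z : H,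
    ∑ i ∈ (ℛ k x).index, ∑ j ∈ (ℛ k y).index,
      toFun (((ℛ k x).left i * (ℛ k y).left j) ⊗ₜ z) *
        toFun ((ℛ k x).right i ⊗ₜ (ℛ k y).right j) =
    ∑ j ∈ (ℛ k y).index, ∑ l ∈ (ℛ k z).index,
      toFun (x ⊗ₜ ((ℛ k y).left j * (ℛ k z).left l)) *
        toFun ((ℛ k y).right j ⊗ₜ (ℛ k z).right l)
  /-- `σ(1, x) = ε(x)`. -/
  one_left : ∀ x : H, toFun (1 ⊗ₜ x) = counit (R := k) x
  /-- `σ(x, 1) = ε(x)`. -/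
  one_right : ∀ x : H, toFun (x ⊗ₜ 1) = counit (R := k) x

section Twist

variable {k H : Type*} [CommRing k] [Ring H] [HopfAlgebra k H]

/-- The twisted product `x ⊗ y ↦ x₍₁₎ y₍₁₎ σ(x₍₂₎, y₍₂₎)`, using that
`Δ(x ⊗ y) = (x₍₁₎ ⊗ y₍₁₎) ⊗ (x₍₂₎ ⊗ y₍₂₎)` on the coalgebra `H ⊗ H`. -/
def twistedMul (σ : H ⊗[k] H →ₗ[k] k) : H ⊗[k] H →ₗ[k] H :=
  (TensorProduct.rid k H).toLinearMap ∘ₗ TensorProduct.map (LinearMap.mul' k H) σ ∘ₗ comul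

/-- The twisted product in Sweedler notation. -/
theorem twistedMul_tmul (σ : H ⊗[k] H →ₗ[k] k) {x y : H} {ι κ : Type*} (r : Repr k x ι)
    (s : Repr k y κ) : twistedMul σ (x ⊗ₜ y) = ∑ i ∈ r.index, ∑ j ∈ s.index,
      σ (r.right i ⊗ₜ s.right j) • (r.left i * s.left j) := by
  simp only [twistedMul, LinearMap.comp_apply, TensorProduct.comul_tmul]
  rw [← r.eq, ← s.eq]
  simp only [TensorProduct.sum_tmul, TensorProduct.tmul_sum, map_sum]
  rw [Finset.sum_comm]
  simp

theorem mul'_comul (x y : H) : comul (R := k) (x * y) =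
    TensorProduct.map (LinearMap.mul' k H) (LinearMap.mul' k H) (comul (R := k) (x ⊗ₜ[k] y)) := by
  rw [Bialgebra.comul_mul, TensorProduct.comul_tmul]
  generalize comul (R := k) x = a
  generalize comul (R := k) y = b
  induction a with
  | zero => simp
  | add u v hu hv => simp only [add_mul, TensorProduct.add_tmul, map_add, hu, hv]
  | tmul c d =>
    induction b with
    | zero => simp
    | add u v hu hv => simp only [mul_add, TensorProduct.tmul_add, map_add, hu, hv]
    | tmul e f => simp

/-- The twisted product is left colinear: `Δ(x ·σ y) = x₍₁₎ y₍₁₎ ⊗ x₍₂₎ ·σ y₍₂₎`. -/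
theorem comul_twistedMul (σ : H ⊗[k] H →ₗ[k] k) (c : H ⊗[k] H) :
    comul (R := k) (twistedMul σ c) =
      TensorProduct.map (LinearMap.mul' k H) (twistedMul σ) (comul (R := k) c) := by
  let L : ((H ⊗[k] H) ⊗[k] (H ⊗[k] H)) ⊗[k] (H ⊗[k] H) →ₗ[k] H ⊗[k] H :=
    (TensorProduct.rid k (H ⊗[k] H)).toLinearMap ∘ₗ TensorProduct.map
      (TensorProduct.map (LinearMap.mul' k H) (LinearMap.mul' k H)) σ
  have hmul : ∀ a : H ⊗[k] H, comul (R := k) (LinearMap.mul' k H a) =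
      TensorProduct.map (LinearMap.mul' k H) (LinearMap.mul' k H) (comul (R := k) a) := by
    intro a
    induction a with
    | zero => simp
    | add u v hu hv => simp only [map_add, hu, hv]
    | tmul x y => rw [LinearMap.mul'_apply, mul'_comul]
  have h1 : ∀ t : (H ⊗[k] H) ⊗[k] (H ⊗[k] H),
      comul (R := k) (TensorProduct.rid k H (TensorProduct.map (LinearMap.mul' k H) σ t)) =
        L ((comul (R := k)).rTensor _ t) := by
    intro t
    induction t with
    | zero => simp
    | add u v hu hv => simp only [map_add, hu, hv]
    | tmul a b => simp [L, hmul]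
  have h2 : ∀ t : (H ⊗[k] H) ⊗[k] (H ⊗[k] H),
      TensorProduct.map (LinearMap.mul' k H) (twistedMul σ) t =
        L ((TensorProduct.assoc k _ _ _).symm ((comul (R := k)).lTensor _ t)) := by
    intro t
    induction t with
    | zero => simp
    | add u v hu hv => simp only [map_add, hu, hv]
    | tmul a b =>
      simp only [TensorProduct.map_tmul, LinearMap.lTensor_tmul, twistedMul, LinearMap.comp_apply]
      generalize comul (R := k) b = u
      induction u with
      | zero => simp
      | add u v hu hv => simp only [map_add, TensorProduct.tmul_add, hu, hv]
      | tmul c d => simp [L]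
  rw [h2, coassoc_symm_apply, ← h1]
  rfl

/-- A presentation of `Δ(x ·σ y)`. -/
def twistedRepr (σ : H ⊗[k] H →ₗ[k] k) {x y : H} {ι κ : Type*} (r : Repr k x ι)
    (s : Repr k y κ) : Repr k (twistedMul σ (x ⊗ₜ y)) (ι × κ) where
  index := r.index ×ˢ s.index
  left p := r.left p.1 * s.left p.2
  right p := twistedMul σ (r.right p.1 ⊗ₜ s.right p.2)
  eq := by
    rw [comul_twistedMul, TensorProduct.comul_tmul, ← r.eq, ← s.eq, Finset.sum_product]
    simp only [TensorProduct.sum_tmul, TensorProduct.tmul_sum, map_sum]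
    rw [Finset.sum_comm]
    simp

theorem RightCocycle.twisted (σ : RightCocycle k H) (x y z : H) :
    σ.toFun (twistedMul σ.toFun (x ⊗ₜ y) ⊗ₜ z) = σ.toFun (x ⊗ₜ twistedMul σ.toFun (y ⊗ₜ z)) := by
  rw [twistedMul_tmul σ.toFun (ℛ k x) (ℛ k y), twistedMul_tmul σ.toFun (ℛ k y) (ℛ k z)]
  simpa only [TensorProduct.sum_tmul, TensorProduct.tmul_sum, ← TensorProduct.smul_tmul',
    TensorProduct.tmul_smul, map_sum, map_smul, smul_eq_mul, mul_comm] using σ.cocycle x y z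

theorem twistedMul_assoc (σ : RightCocycle k H) (x y z : H) :
    twistedMul σ.toFun (twistedMul σ.toFun (x ⊗ₜ y) ⊗ₜ z) =
      twistedMul σ.toFun (x ⊗ₜ twistedMul σ.toFun (y ⊗ₜ z)) := by
  rw [twistedMul_tmul σ.toFun (twistedRepr σ.toFun (ℛ k x) (ℛ k y)) (ℛ k z),
    twistedMul_tmul σ.toFun (ℛ k x) (twistedRepr σ.toFun (ℛ k y) (ℛ k z))]
  simp only [twistedRepr, Finset.sum_product, σ.twisted, mul_assoc]

theorem sum_counit_right {x : H} {ι : Type*} (r : Repr k x ι) :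
    ∑ i ∈ r.index, counit (R := k) (r.right i) • r.left i = x := by
  have h := congrArg (TensorProduct.rid k H) (lTensor_counit_comul (R := k) x)
  rw [← r.eq] at h
  simpa only [map_sum, LinearMap.lTensor_tmul, TensorProduct.rid_tmul, one_smul] using h

/-- The presentation `Δ 1 = 1 ⊗ 1`. -/
def oneRepr : Repr k (1 : H) Unit where
  index := {()}
  left _ := 1
  right _ := 1
  eq := by simp [Algebra.TensorProduct.one_def]

theorem one_twistedMul (σ : RightCocycle k H) (x : H) : twistedMul σ.toFun (1 ⊗ₜ x) = x := by
  rw [twistedMul_tmul σ.toFun oneRepr (ℛ k x)]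
  simpa [oneRepr, σ.one_left] using sum_counit_right (ℛ k x)

theorem twistedMul_one (σ : RightCocycle k H) (x : H) : twistedMul σ.toFun (x ⊗ₜ 1) = x := by
  rw [twistedMul_tmul σ.toFun (ℛ k x) oneRepr]
  simpa [oneRepr, σ.one_right] using sum_counit_right (ℛ k x)

/-- The algebra `H_σ`: the module `H` with the twisted product
`x ·σ y = x₍₁₎ y₍₁₎ σ(x₍₂₎, y₍₂₎)`. -/
@[nolint unusedArguments]
def Twist (_σ : RightCocycle k H) : Type _ := H

variable (σ : RightCocycle k H)

instance instAddCommGroupTwist : AddCommGroup (Twist σ) := inferInstanceAs (AddCommGroup H)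

instance : Module k (Twist σ) := inferInstanceAs (Module k H)

/-- The identity map `H → H_σ`, as a linear equivalence. -/
def toTwist : H ≃ₗ[k] Twist σ := LinearEquiv.refl k H

instance : Mul (Twist σ) where
  mul x y := toTwist σ (twistedMul σ.toFun ((toTwist σ).symm x ⊗ₜ (toTwist σ).symm y))

instance : One (Twist σ) where
  one := toTwist σ 1

theorem toTwist_one : toTwist σ 1 = 1 := rfl

theorem toTwist_mul (x y : H) :
    toTwist σ x * toTwist σ y = toTwist σ (twistedMul σ.toFun (x ⊗ₜ y)) := rfl

instance : Ring (Twist σ) where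
  __ := instAddCommGroupTwist σ
  mul := (· * ·)
  one := 1
  zsmul := fun n x => n • x
  left_distrib x y z := by
    obtain ⟨x, rfl⟩ := (toTwist σ).surjective x
    obtain ⟨y, rfl⟩ := (toTwist σ).surjective y
    obtain ⟨z, rfl⟩ := (toTwist σ).surjective z
    exact congrArg (toTwist σ) (show twistedMul σ.toFun (x ⊗ₜ (y + z)) =
      twistedMul σ.toFun (x ⊗ₜ y) + twistedMul σ.toFun (x ⊗ₜ z) by
        rw [TensorProduct.tmul_add, map_add])
  right_distrib x y z := by
    obtain ⟨x, rfl⟩ := (toTwist σ).surjective x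
    obtain ⟨y, rfl⟩ := (toTwist σ).surjective y
    obtain ⟨z, rfl⟩ := (toTwist σ).surjective z
    exact congrArg (toTwist σ) (show twistedMul σ.toFun ((x + y) ⊗ₜ z) =
      twistedMul σ.toFun (x ⊗ₜ z) + twistedMul σ.toFun (y ⊗ₜ z) by
        rw [TensorProduct.add_tmul, map_add])
  zero_mul x := by
    obtain ⟨x, rfl⟩ := (toTwist σ).surjective x
    exact congrArg (toTwist σ) (show twistedMul σ.toFun (0 ⊗ₜ x) = 0 by
      rw [TensorProduct.zero_tmul, map_zero])
  mul_zero x := by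
    obtain ⟨x, rfl⟩ := (toTwist σ).surjective x
    exact congrArg (toTwist σ) (show twistedMul σ.toFun (x ⊗ₜ 0) = 0 by
      rw [TensorProduct.tmul_zero, map_zero])
  mul_assoc x y z := by
    obtain ⟨x, rfl⟩ := (toTwist σ).surjective x
    obtain ⟨y, rfl⟩ := (toTwist σ).surjective y
    obtain ⟨z, rfl⟩ := (toTwist σ).surjective z
    exact congrArg (toTwist σ) (twistedMul_assoc σ x y z)
  one_mul x := congrArg (toTwist σ) (one_twistedMul σ ((toTwist σ).symm x))
  mul_one x := congrArg (toTwist σ) (twistedMul_one σ ((toTwist σ).symm x))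

instance : Algebra k (Twist σ) :=
  Algebra.ofModule
    (fun r x y => by
      obtain ⟨x, rfl⟩ := (toTwist σ).surjective x
      obtain ⟨y, rfl⟩ := (toTwist σ).surjective y
      exact congrArg (toTwist σ) (show twistedMul σ.toFun ((r • x) ⊗ₜ y) =
        r • twistedMul σ.toFun (x ⊗ₜ y) by rw [← TensorProduct.smul_tmul', map_smul]))
    (fun r x y => by
      obtain ⟨x, rfl⟩ := (toTwist σ).surjective x
      obtain ⟨y, rfl⟩ := (toTwist σ).surjective y
      exact congrArg (toTwist σ) (show twistedMul σ.toFun (x ⊗ₜ (r • y)) =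
        r • twistedMul σ.toFun (x ⊗ₜ y) by rw [TensorProduct.tmul_smul, map_smul]))

/-- The comultiplication of `H`, viewed as a linear map `H_σ → H ⊗ H_σ`. -/
def twistCoactionLin : Twist σ →ₗ[k] H ⊗[k] Twist σ :=
  (toTwist σ).toLinearMap.lTensor H ∘ₗ (comul : H →ₗ[k] H ⊗[k] H) ∘ₗ
    (toTwist σ).symm.toLinearMap

theorem twistCoactionLin_toTwist (x : H) : twistCoactionLin σ (toTwist σ x) =
    (toTwist σ).toLinearMap.lTensor H (comul (R := k) x) := by
  simp [twistCoactionLin]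

theorem twistCoactionLin_mul (x y : Twist σ) :
    twistCoactionLin σ (x * y) = twistCoactionLin σ x * twistCoactionLin σ y := by
  obtain ⟨x, rfl⟩ := (toTwist σ).surjective x
  obtain ⟨y, rfl⟩ := (toTwist σ).surjective y
  rw [toTwist_mul]
  simp only [twistCoactionLin_toTwist]
  rw [comul_twistedMul, TensorProduct.comul_tmul]
  generalize comul (R := k) x = a
  generalize comul (R := k) y = b
  induction a with
  | zero => simp
  | add u v hu hv => simp only [add_mul, TensorProduct.add_tmul, map_add, hu, hv]
  | tmul c d =>
    induction b with
    | zero => simp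
    | add u v hu hv => simp only [mul_add, TensorProduct.tmul_add, map_add, hu, hv]
    | tmul e f => simp [toTwist_mul]

theorem twistCoactionLin_coassoc (x : Twist σ) :
    TensorProduct.assoc k H H (Twist σ)
      ((comul : H →ₗ[k] H ⊗[k] H).rTensor (Twist σ) (twistCoactionLin σ x)) =
    (twistCoactionLin σ).lTensor H (twistCoactionLin σ x) := by
  obtain ⟨x, rfl⟩ := (toTwist σ).surjective x
  have h1 : ∀ t : H ⊗[k] H, TensorProduct.assoc k H H (Twist σ)
      ((comul : H →ₗ[k] H ⊗[k] H).rTensor (Twist σ) ((toTwist σ).toLinearMap.lTensor H t)) =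
      ((toTwist σ).toLinearMap.lTensor H).lTensor H
        (TensorProduct.assoc k H H H ((comul : H →ₗ[k] H ⊗[k] H).rTensor H t)) := by
    intro t
    induction t with
    | zero => simp
    | add u v hu hv => simp only [map_add, hu, hv]
    | tmul a b =>
      simp only [LinearMap.lTensor_tmul, LinearMap.rTensor_tmul]
      generalize comul (R := k) a = c
      induction c with
      | zero => simp
      | add u v hu hv => simp only [map_add, TensorProduct.add_tmul, hu, hv]
      | tmul d e => simp
  have h2 : ∀ t : H ⊗[k] H,
      (twistCoactionLin σ).lTensor H ((toTwist σ).toLinearMap.lTensor H t) =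
      ((toTwist σ).toLinearMap.lTensor H).lTensor H
        ((comul : H →ₗ[k] H ⊗[k] H).lTensor H t) := by
    intro t
    induction t with
    | zero => simp
    | add u v hu hv => simp only [map_add, hu, hv]
    | tmul a b =>
      simp only [LinearMap.lTensor_tmul, LinearEquiv.coe_coe, twistCoactionLin_toTwist]
  rw [twistCoactionLin_toTwist, h1, coassoc_apply, h2]

theorem twistCoactionLin_counital (x : Twist σ) :
    (counit : H →ₗ[k] k).rTensor (Twist σ) (twistCoactionLin σ x) = 1 ⊗ₜ x := by
  obtain ⟨x, rfl⟩ := (toTwist σ).surjective x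
  have h1 : ∀ t : H ⊗[k] H,
      (counit : H →ₗ[k] k).rTensor (Twist σ) ((toTwist σ).toLinearMap.lTensor H t) =
      (toTwist σ).toLinearMap.lTensor k ((counit : H →ₗ[k] k).rTensor H t) := by
    intro t
    induction t with
    | zero => simp
    | add u v hu hv => simp only [map_add, hu, hv]
    | tmul a b => simp
  rw [twistCoactionLin_toTwist, h1, rTensor_counit_comul]
  simp

/-- The comultiplication of `H`, viewed as an algebra map `H_σ → H ⊗ H_σ`. -/
def twistCoaction : Twist σ →ₐ[k] H ⊗[k] Twist σ :=
  AlgHom.ofLinearMap (twistCoactionLin σ)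
    (by
      rw [← toTwist_one, twistCoactionLin_toTwist]
      simp [Algebra.TensorProduct.one_def, toTwist_one])
    (twistCoactionLin_mul σ)

/-- The coaction of `H` on `H_σ` is the comultiplication of `H`. -/
instance : LeftComoduleAlgebra k H (Twist σ) where
  coaction := twistCoaction σ
  coassoc := LinearMap.ext (twistCoactionLin_coassoc σ)
  counital := LinearMap.ext (twistCoactionLin_counital σ)

theorem coaction_toTwist (x : H) : coaction k H (Twist σ) (toTwist σ x) =
    (toTwist σ).toLinearMap.lTensor H (comul (R := k) x) :=
  twistCoactionLin_toTwist σ x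

end Twist

/-- `Z` is a cleft `H`-Galois object: an `H`-Galois object that is isomorphic, as an
`H`-comodule algebra, to `H_σ` for some right invertible cocycle `σ`. -/
structure IsCleftGaloisObject (k H Z : Type*) [CommRing k] [Ring H] [HopfAlgebra k H]
    [Ring Z] [Algebra k Z] [LeftComoduleAlgebra k H Z] : Prop
    extends IsGaloisObject k H Z where
  cleft : ∃ σ : RightCocycle k H, ComoduleAlgebraIso k H (Twist σ) Z

end HopfGalois

namespace QuantumBilinear

/-! ### The algebras `B(E, F)` -/

/-- A matrix over `k`, viewed as a matrix over the `k`-algebra `A`. -/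
def scalarMatrix {k : Type*} [CommRing k] (A : Type*) [Ring A] [Algebra k A] {n m : ℕ}
    (M : Matrix (Fin n) (Fin m) k) : Matrix (Fin n) (Fin m) A :=
  M.map (algebraMap k A)

/-- The matrix `F⁻¹ zᵗ E z`, for an `n × m` matrix `z` over a `k`-algebra. -/
def leftWord {k : Type*} [CommRing k] {A : Type*} [Ring A] [Algebra k A] {n m : ℕ}
    (E : GL (Fin n) k) (F : GL (Fin m) k) (z : Matrix (Fin n) (Fin m) A) :
    Matrix (Fin m) (Fin m) A :=
  scalarMatrix A (F⁻¹).val * zᵀ * scalarMatrix A E.val * z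

/-- The matrix `z F⁻¹ zᵗ E`, for an `n × m` matrix `z` over a `k`-algebra. -/
def rightWord {k : Type*} [CommRing k] {A : Type*} [Ring A] [Algebra k A] {n m : ℕ}
    (E : GL (Fin n) k) (F : GL (Fin m) k) (z : Matrix (Fin n) (Fin m) A) :
    Matrix (Fin n) (Fin n) A :=
  z * scalarMatrix A (F⁻¹).val * zᵀ * scalarMatrix A E.val

/-- The defining relations of `B(E, F)`, for an `n × m` matrix `z` over a `k`-algebra:
`F⁻¹ zᵗ E z = I_m` and `z F⁻¹ zᵗ E = I_n`. -/
def Relations {k : Type*} [CommRing k] {A : Type*} [Ring A] [Algebra k A] {n m : ℕ}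
    (E : GL (Fin n) k) (F : GL (Fin m) k) (z : Matrix (Fin n) (Fin m) A) : Prop :=
  leftWord E F z = 1 ∧ rightWord E F z = 1

/-- The matrix of free generators `z i j`. -/
def freeGen (k : Type*) [CommRing k] (n m : ℕ) :
    Matrix (Fin n) (Fin m) (FreeAlgebra k (Fin n × Fin m)) :=
  Matrix.of fun i j => FreeAlgebra.ι k (i, j)

/-- The relations imposed on the free algebra, entry by entry. -/
inductive Rel {k : Type*} [CommRing k] {n m : ℕ} (E : GL (Fin n) k) (F : GL (Fin m) k) :
    FreeAlgebra k (Fin n × Fin m) → FreeAlgebra k (Fin n × Fin m) → Prop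
  | left (i j : Fin m) : Rel E F (leftWord E F (freeGen k n m) i j)
      ((1 : Matrix (Fin m) (Fin m) (FreeAlgebra k (Fin n × Fin m))) i j)
  | right (i j : Fin n) : Rel E F (rightWord E F (freeGen k n m) i j)
      ((1 : Matrix (Fin n) (Fin n) (FreeAlgebra k (Fin n × Fin m))) i j)

/-- The `k`-algebra `B(E, F)` generated by the entries of an `n × m` matrix `z` subject to
`F⁻¹ zᵗ E z = I_m` and `z F⁻¹ zᵗ E = I_n`. -/
def GalAlg {k : Type*} [CommRing k] {n m : ℕ} (E : GL (Fin n) k) (F : GL (Fin m) k) : Type _ :=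
  RingQuot (Rel E F)

/-- The algebra `B(E)`: its generators `a i j` are subject to
`E⁻¹ aᵗ E a = I_n = a E⁻¹ aᵗ E`, which are the relations of `B(E, E)`. -/
abbrev HopfAlg {k : Type*} [CommRing k] {n : ℕ} (E : GL (Fin n) k) : Type _ := GalAlg E E

section Basic

variable {k : Type*} [CommRing k] {n m : ℕ} (E : GL (Fin n) k) (F : GL (Fin m) k)

instance : Ring (GalAlg E F) := inferInstanceAs (Ring (RingQuot (Rel E F)))

instance : Algebra k (GalAlg E F) := inferInstanceAs (Algebra k (RingQuot (Rel E F)))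

/-- The projection from the free algebra onto `B(E, F)`. -/
def mk : FreeAlgebra k (Fin n × Fin m) →ₐ[k] GalAlg E F := RingQuot.mkAlgHom k (Rel E F)

/-- The matrix of canonical generators of `B(E, F)`. -/
def gen : Matrix (Fin n) (Fin m) (GalAlg E F) :=
  Matrix.of fun i j => mk E F (FreeAlgebra.ι k (i, j))

variable {A B : Type*} [Ring A] [Algebra k A] [Ring B] [Algebra k B]

theorem scalarMatrix_map (f : A →ₐ[k] B) (M : Matrix (Fin n) (Fin m) k) :
    (scalarMatrix A M).map f = scalarMatrix B M := by
  ext i j; simp [scalarMatrix]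

theorem leftWord_map (f : A →ₐ[k] B) (z : Matrix (Fin n) (Fin m) A) :
    leftWord E F (z.map f) = (leftWord E F z).map f := by
  simp only [leftWord, Matrix.map_mul, Matrix.transpose_map, scalarMatrix_map]

theorem rightWord_map (f : A →ₐ[k] B) (z : Matrix (Fin n) (Fin m) A) :
    rightWord E F (z.map f) = (rightWord E F z).map f := by
  simp only [rightWord, Matrix.map_mul, Matrix.transpose_map, scalarMatrix_map]

theorem one_map_algHom (f : A →ₐ[k] B) :
    (1 : Matrix (Fin n) (Fin n) A).map f = 1 :=
  Matrix.map_one _ (map_zero f) (map_one f)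

theorem gen_relations : Relations E F (gen E F) := by
  have hg : gen E F = (freeGen k n m).map (mk E F) := rfl
  rw [hg, Relations, leftWord_map, rightWord_map]
  constructor
  · rw [← one_map_algHom (mk E F)]
    ext i j
    exact RingQuot.mkAlgHom_rel k (Rel.left (E := E) (F := F) i j)
  · rw [← one_map_algHom (mk E F)]
    ext i j
    exact RingQuot.mkAlgHom_rel k (Rel.right (E := E) (F := F) i j)

/-- The algebra map from the free algebra sending `z i j` to `T i j`. -/
def freeLift (T : Matrix (Fin n) (Fin m) A) : FreeAlgebra k (Fin n × Fin m) →ₐ[k] A :=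
  FreeAlgebra.lift k fun p : Fin n × Fin m => T p.1 p.2

theorem freeGen_map (T : Matrix (Fin n) (Fin m) A) :
    (freeGen k n m).map (freeLift T) = T := by
  ext i j; simp [freeGen, freeLift]

theorem freeLift_rel (T : Matrix (Fin n) (Fin m) A) (hT : Relations E F T)
    ⦃x y : FreeAlgebra k (Fin n × Fin m)⦄ (h : Rel E F x y) :
    freeLift (k := k) T x = freeLift (k := k) T y := by
  rw [← freeGen_map (k := k) T, Relations, leftWord_map, rightWord_map] at hT
  obtain ⟨h1, h2⟩ := hT
  rw [← one_map_algHom (freeLift (k := k) T)] at h1 h2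
  rcases h with ⟨i, j⟩ | ⟨i, j⟩
  · exact congrFun (congrFun h1 i) j
  · exact congrFun (congrFun h2 i) j

/-- The universal property of `B(E, F)`: the algebra map sending `z i j` to `T i j`. -/
def lift (T : Matrix (Fin n) (Fin m) A) (hT : Relations E F T) : GalAlg E F →ₐ[k] A :=
  RingQuot.liftAlgHom k ⟨freeLift T, freeLift_rel E F T hT⟩

variable {E F}

@[simp] theorem lift_gen (T : Matrix (Fin n) (Fin m) A) (hT : Relations E F T) (i : Fin n)
    (j : Fin m) : lift E F T hT (gen E F i j) = T i j := by
  refine (RingQuot.liftAlgHom_mkAlgHom_apply k _ _ _).trans ?_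
  simp [freeLift]

theorem algHom_ext {f g : GalAlg E F →ₐ[k] A} (h : ∀ i j, f (gen E F i j) = g (gen E F i j)) :
    f = g := by
  refine RingQuot.ringQuot_ext' k f g ?_
  ext ⟨i, j⟩
  exact h i j

/-- Induction principle: `B(E, F)` is generated by the entries of `z`. -/
theorem induction_gen {P : GalAlg E F → Prop} (hgen : ∀ i j, P (gen E F i j))
    (halg : ∀ r : k, P (algebraMap k _ r)) (hadd : ∀ x y, P x → P y → P (x + y))
    (hmul : ∀ x y, P x → P y → P (x * y)) (x : GalAlg E F) : P x := by
  obtain ⟨y, rfl⟩ : ∃ y, mk E F y = x := RingQuot.mkAlgHom_surjective k (Rel E F) x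
  induction y using FreeAlgebra.induction with
  | grade0 r =>
    have := halg r
    rw [← AlgHom.commutes (mk E F) r] at this
    exact this
  | grade1 p => exact hgen p.1 p.2
  | mul a b ha hb => rw [map_mul]; exact hmul _ _ ha hb
  | add a b ha hb => rw [map_add]; exact hadd _ _ ha hb

/-! ### Matrix identities -/

theorem scalarMatrix_mul {p q r : ℕ} (M : Matrix (Fin p) (Fin q) k) (N : Matrix (Fin q) (Fin r) k) :
    scalarMatrix A (M * N) = scalarMatrix A M * scalarMatrix A N := by
  simp [scalarMatrix, Matrix.map_mul]

theorem scalarMatrix_one {p : ℕ} : scalarMatrix A (1 : Matrix (Fin p) (Fin p) k) = 1 := by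
  simp [scalarMatrix]

theorem scalarMatrix_inv_mul (E : GL (Fin n) k) :
    scalarMatrix A (E⁻¹).val * scalarMatrix A E.val = 1 := by
  rw [← scalarMatrix_mul, ← Units.val_mul, inv_mul_cancel, Units.val_one, scalarMatrix_one]

theorem scalarMatrix_mul_inv (E : GL (Fin n) k) :
    scalarMatrix A E.val * scalarMatrix A (E⁻¹).val = 1 := by
  rw [← scalarMatrix_mul, ← Units.val_mul, mul_inv_cancel, Units.val_one, scalarMatrix_one]

theorem scalarMatrix_transpose_mul_inv (E : GL (Fin n) k) :
    (scalarMatrix A E.val)ᵀ * (scalarMatrix A (E⁻¹).val)ᵀ = 1 := by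
  have h : ∀ M : Matrix (Fin n) (Fin n) k, (scalarMatrix A M)ᵀ = scalarMatrix A Mᵀ := fun _ => rfl
  rw [h, h, ← scalarMatrix_mul, ← Matrix.transpose_mul, ← Units.val_mul, inv_mul_cancel,
    Units.val_one, Matrix.transpose_one, scalarMatrix_one]

theorem scalarMatrix_transpose_inv_mul (E : GL (Fin n) k) :
    (scalarMatrix A (E⁻¹).val)ᵀ * (scalarMatrix A E.val)ᵀ = 1 := by
  have h : ∀ M : Matrix (Fin n) (Fin n) k, (scalarMatrix A M)ᵀ = scalarMatrix A Mᵀ := fun _ => rfl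
  rw [h, h, ← scalarMatrix_mul, ← Matrix.transpose_mul, ← Units.val_mul, mul_inv_cancel,
    Units.val_one, Matrix.transpose_one, scalarMatrix_one]

/-- Transposition reverses products of matrices whose entries commute with each other. -/
theorem transpose_mul_of_commute {p q r : ℕ} (M : Matrix (Fin p) (Fin q) A)
    (N : Matrix (Fin q) (Fin r) A) (h : ∀ i j i' j', Commute (M i j) (N i' j')) :
    (M * N)ᵀ = Nᵀ * Mᵀ := by
  ext i j
  simp only [Matrix.transpose_apply, Matrix.mul_apply]
  exact Finset.sum_congr rfl fun l _ => h _ _ _ _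

theorem scalarMatrix_commute {p q r s : ℕ} (M : Matrix (Fin p) (Fin q) k)
    (N : Matrix (Fin r) (Fin s) A) (i : Fin p) (j : Fin q) (i' : Fin r) (j' : Fin s) :
    Commute (scalarMatrix A M i j) (N i' j') :=
  Algebra.commutes _ _

theorem Relations.map {T : Matrix (Fin n) (Fin m) A} (hT : Relations E F T) (f : A →ₐ[k] B) :
    Relations E F (T.map f) := by
  rw [Relations, leftWord_map, rightWord_map, hT.1, hT.2]
  exact ⟨one_map_algHom f, one_map_algHom f⟩

theorem Relations.transpose_mul_mul {T : Matrix (Fin n) (Fin m) A} (hT : Relations E F T) :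
    Tᵀ * scalarMatrix A E.val * T = scalarMatrix A F.val := by
  have h := congrArg (fun X => scalarMatrix A F.val * X) hT.1
  simp only [leftWord, ← Matrix.mul_assoc] at h
  rwa [scalarMatrix_mul_inv, Matrix.one_mul, Matrix.mul_one] at h

theorem Relations.mul_mul_transpose {T : Matrix (Fin n) (Fin m) A} (hT : Relations E F T) :
    T * scalarMatrix A (F⁻¹).val * Tᵀ = scalarMatrix A (E⁻¹).val := by
  have h := congrArg (fun X => X * scalarMatrix A (E⁻¹).val) hT.2
  simp only [rightWord, Matrix.mul_assoc] at h
  rwa [scalarMatrix_mul_inv, Matrix.one_mul, Matrix.mul_one, ← Matrix.mul_assoc] at h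

/-- Composition of solutions with mutually commuting entries. -/
theorem Relations.mul {p : ℕ} {G : GL (Fin p) k} {S : Matrix (Fin n) (Fin m) A}
    {T : Matrix (Fin m) (Fin p) A} (hS : Relations E F S) (hT : Relations F G T)
    (h : ∀ i j i' j', Commute (S i j) (T i' j')) : Relations E G (S * T) := by
  have hS1 := hS.transpose_mul_mul
  have hT2 := hT.mul_mul_transpose
  constructor
  · rw [leftWord, transpose_mul_of_commute S T h]
    calc scalarMatrix A (G⁻¹).val * (Tᵀ * Sᵀ) * scalarMatrix A E.val * (S * T)
        = scalarMatrix A (G⁻¹).val * Tᵀ * (Sᵀ * scalarMatrix A E.val * S) * T := by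
          simp only [Matrix.mul_assoc]
      _ = 1 := by rw [hS1]; exact hT.1
  · rw [rightWord, transpose_mul_of_commute S T h]
    calc S * T * scalarMatrix A (G⁻¹).val * (Tᵀ * Sᵀ) * scalarMatrix A E.val
        = S * (T * scalarMatrix A (G⁻¹).val * Tᵀ) * Sᵀ * scalarMatrix A E.val := by
          simp only [Matrix.mul_assoc]
      _ = 1 := by rw [hT2]; exact hS.2

theorem relations_one : Relations E E (1 : Matrix (Fin n) (Fin n) A) := by
  constructor
  · rw [leftWord, Matrix.transpose_one, Matrix.mul_one, Matrix.mul_one, scalarMatrix_inv_mul]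
  · rw [rightWord, Matrix.transpose_one, Matrix.one_mul, Matrix.mul_one, scalarMatrix_inv_mul]

end Basic

/-! ### The coaction `δ(z i j) = ∑ₗ a i l ⊗ z l j` -/

section Coaction

variable {k : Type*} [CommRing k] {n m : ℕ} (E : GL (Fin n) k) (F : GL (Fin m) k)

theorem relations_coaction : Relations E F
    ((gen E E).map (Algebra.TensorProduct.includeLeft : HopfAlg E →ₐ[k] HopfAlg E ⊗[k] GalAlg E F) *
      (gen E F).map
        (Algebra.TensorProduct.includeRight : GalAlg E F →ₐ[k] HopfAlg E ⊗[k] GalAlg E F)) := by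
  refine ((gen_relations E E).map _).mul ((gen_relations E F).map _) fun i j i' j' => ?_
  simp [Commute, SemiconjBy]

/-- The algebra map `δ : B(E, F) → B(E) ⊗ B(E, F)`, `δ(z i j) = ∑ₗ a i l ⊗ z l j`. For `F = E`
it is the comultiplication of `B(E)`. -/
def coact : GalAlg E F →ₐ[k] HopfAlg E ⊗[k] GalAlg E F := lift E F _ (relations_coaction E F)

@[simp] theorem coact_gen (i : Fin n) (j : Fin m) :
    coact E F (gen E F i j) = ∑ l, gen E E i l ⊗ₜ[k] gen E F l j := by
  simp [coact, Matrix.mul_apply]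

/-- The counit `ε(a i j) = δ i j`. -/
def counitHom : HopfAlg E →ₐ[k] k := lift E E 1 relations_one

@[simp] theorem counitHom_gen (i j : Fin n) :
    counitHom E (gen E E i j) = (1 : Matrix (Fin n) (Fin n) k) i j := by
  simp [counitHom]

theorem coact_coassoc :
    (Algebra.TensorProduct.assoc k k k (HopfAlg E) (HopfAlg E) (GalAlg E F)).toAlgHom.comp
      ((Algebra.TensorProduct.map (coact E E) (.id k (GalAlg E F))).comp (coact E F)) =
    (Algebra.TensorProduct.map (.id k (HopfAlg E)) (coact E F)).comp (coact E F) := by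
  apply algHom_ext
  intro i j
  simp [TensorProduct.sum_tmul, TensorProduct.tmul_sum]
  exact Finset.sum_comm

theorem counit_coact :
    (Algebra.TensorProduct.map (counitHom E) (.id k (GalAlg E F))).comp (coact E F) =
      (Algebra.TensorProduct.lid k (GalAlg E F)).symm := by
  apply algHom_ext
  intro i j
  simp [Matrix.one_apply, TensorProduct.ite_tmul]

theorem coact_counit :
    (Algebra.TensorProduct.map (.id k (HopfAlg E)) (counitHom E)).comp (coact E E) =
      (Algebra.TensorProduct.rid k k (HopfAlg E)).symm := by
  apply algHom_ext
  intro i j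
  simp [Matrix.one_apply, TensorProduct.tmul_ite]

instance : Bialgebra k (HopfAlg E) :=
  Bialgebra.ofAlgHom (coact E E) (counitHom E) (coact_coassoc E E) (counit_coact E E)
    (coact_counit E)

theorem comul_eq (x : HopfAlg E) : Coalgebra.comul (R := k) x = coact E E x := rfl

theorem counit_eq (x : HopfAlg E) : Coalgebra.counit (R := k) x = counitHom E x := rfl

end Coaction

/-! ### The antipode `S(a) = E⁻¹ aᵗ E` -/

section Antipode

variable {k : Type*} [CommRing k] {n : ℕ} (E : GL (Fin n) k)

/-- The matrix `E⁻¹ aᵗ E`. -/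
def antipodeMatrix : Matrix (Fin n) (Fin n) (HopfAlg E) :=
  scalarMatrix _ (E⁻¹).val * (gen E E)ᵀ * scalarMatrix _ E.val

theorem antipodeMatrix_mul : antipodeMatrix E * gen E E = 1 := (gen_relations E E).1

theorem mul_antipodeMatrix : gen E E * antipodeMatrix E = 1 := by
  have := (gen_relations E E).2
  simpa [rightWord, antipodeMatrix, Matrix.mul_assoc] using this

theorem map_op_mul {A : Type*} [Ring A] {p q r : ℕ} (X : Matrix (Fin p) (Fin q) A)
    (Y : Matrix (Fin q) (Fin r) A) :
    X.map MulOpposite.op * Y.map MulOpposite.op = ((Yᵀ * Xᵀ)ᵀ).map MulOpposite.op := by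
  ext i j
  simp [Matrix.mul_apply]

theorem relations_antipode : Relations E E ((antipodeMatrix E).map MulOpposite.op) := by
  set s := antipodeMatrix E with hs
  have hsc : ∀ M : Matrix (Fin n) (Fin n) k, scalarMatrix (HopfAlg E)ᵐᵒᵖ M =
      (scalarMatrix (HopfAlg E) M).map MulOpposite.op := fun M => rfl
  have hst : sᵀ = (scalarMatrix _ E.val)ᵀ * gen E E * (scalarMatrix _ (E⁻¹).val)ᵀ := by
    rw [hs, antipodeMatrix, Matrix.mul_assoc, transpose_mul_of_commute,
      transpose_mul_of_commute, Matrix.transpose_transpose]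
    · exact fun i j i' j' => (scalarMatrix_commute _ _ _ _ _ _).symm
    · exact fun i j i' j' => scalarMatrix_commute _ _ _ _ _ _
  have h1 := (gen_relations E E).1
  have h2 := (gen_relations E E).2
  have e1 := scalarMatrix_transpose_mul_inv (A := HopfAlg E) E
  have e2 := scalarMatrix_transpose_inv_mul (A := HopfAlg E) E
  have hone : (1 : Matrix (Fin n) (Fin n) (HopfAlg E)ᵐᵒᵖ) =
      ((1 : Matrix (Fin n) (Fin n) (HopfAlg E))ᵀ).map MulOpposite.op := by
    rw [Matrix.transpose_one, Matrix.map_one _ MulOpposite.op_zero MulOpposite.op_one]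
  constructor
  · rw [leftWord, hsc, hsc, ← Matrix.transpose_map, map_op_mul, map_op_mul, map_op_mul, hone]
    congr 2
    simp only [Matrix.transpose_transpose]
    calc sᵀ * ((scalarMatrix _ E.val)ᵀ * (s * (scalarMatrix _ (E⁻¹).val)ᵀ))
        = (scalarMatrix _ E.val)ᵀ * gen E E *
            ((scalarMatrix _ (E⁻¹).val)ᵀ * (scalarMatrix _ E.val)ᵀ) * s *
              (scalarMatrix _ (E⁻¹).val)ᵀ := by
          rw [hst]; simp only [Matrix.mul_assoc]
      _ = (scalarMatrix _ E.val)ᵀ * (gen E E * s) * (scalarMatrix _ (E⁻¹).val)ᵀ := by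
          rw [e2]; simp only [Matrix.mul_assoc, Matrix.mul_one]
      _ = 1 := by rw [hs, mul_antipodeMatrix, Matrix.mul_one, e1]
  · rw [rightWord, hsc, hsc, ← Matrix.transpose_map, map_op_mul, map_op_mul, map_op_mul, hone]
    congr 2
    simp only [Matrix.transpose_transpose]
    calc (scalarMatrix _ E.val)ᵀ * (s * ((scalarMatrix _ (E⁻¹).val)ᵀ * sᵀ))
        = (scalarMatrix _ E.val)ᵀ * (s * ((scalarMatrix _ (E⁻¹).val)ᵀ *
            (scalarMatrix _ E.val)ᵀ) * gen E E) * (scalarMatrix _ (E⁻¹).val)ᵀ := by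
          rw [hst]; simp only [Matrix.mul_assoc]
      _ = 1 := by rw [e2, Matrix.mul_one, hs, antipodeMatrix_mul, Matrix.mul_one, e1]

/-- The antipode as an algebra map to the opposite algebra. -/
def antipodeOp : HopfAlg E →ₐ[k] (HopfAlg E)ᵐᵒᵖ := lift E E _ (relations_antipode E)

/-- The antipode of `B(E)`: the anti-multiplicative map with `S(a) = E⁻¹ aᵗ E`. -/
def antipodeLin : HopfAlg E →ₗ[k] HopfAlg E :=
  (MulOpposite.opLinearEquiv k).symm.toLinearMap ∘ₗ (antipodeOp E).toLinearMap

@[simp] theorem antipodeLin_gen (i j : Fin n) :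
    antipodeLin E (gen E E i j) = antipodeMatrix E i j := by
  simp [antipodeLin, antipodeOp]

theorem antipodeLin_mul (x y : HopfAlg E) :
    antipodeLin E (x * y) = antipodeLin E y * antipodeLin E x := by
  simp [antipodeLin]

theorem antipodeLin_algebraMap (r : k) :
    antipodeLin E (algebraMap k _ r) = algebraMap k _ r := by
  simp [antipodeLin]

theorem antipode_left (x : HopfAlg E) :
    LinearMap.mul' k _ ((antipodeLin E).rTensor _ (coact E E x)) =
      algebraMap k _ (counitHom E x) := by
  induction x using induction_gen with
  | hgen i j =>
    have h := congrFun (congrFun (antipodeMatrix_mul E) i) j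
    simp only [Matrix.mul_apply] at h
    simp only [coact_gen, counitHom_gen, map_sum, LinearMap.rTensor_tmul,
      LinearMap.mul'_apply, antipodeLin_gen, h, Matrix.one_apply]
    split_ifs <;> simp
  | halg r => simp [Algebra.TensorProduct.algebraMap_apply, antipodeLin_algebraMap]
  | hadd x y hx hy => simp [hx, hy]
  | hmul x y hx hy =>
    have key : ∀ (t : HopfAlg E ⊗[k] HopfAlg E) (c d : HopfAlg E),
        LinearMap.mul' k _ ((antipodeLin E).rTensor _ (t * c ⊗ₜ d)) =
          antipodeLin E c * LinearMap.mul' k _ ((antipodeLin E).rTensor _ t) * d := by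
      intro t c d
      induction t with
      | zero => simp
      | add u v hu hv => simp only [add_mul, mul_add, map_add, hu, hv]
      | tmul a b => simp [antipodeLin_mul, mul_assoc]
    have key2 : ∀ u : HopfAlg E ⊗[k] HopfAlg E,
        LinearMap.mul' k _ ((antipodeLin E).rTensor _ (coact E E x * u)) =
          algebraMap k _ (counitHom E x) * LinearMap.mul' k _ ((antipodeLin E).rTensor _ u) := by
      intro u
      induction u with
      | zero => simp
      | add u v hu hv => simp only [map_add, mul_add, hu, hv]
      | tmul c d =>
        rw [key, hx, ← Algebra.commutes]
        simp [mul_assoc]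
    rw [map_mul, key2, hy, map_mul, map_mul]

theorem antipode_right (x : HopfAlg E) :
    LinearMap.mul' k _ ((antipodeLin E).lTensor _ (coact E E x)) =
      algebraMap k _ (counitHom E x) := by
  induction x using induction_gen with
  | hgen i j =>
    have h := congrFun (congrFun (mul_antipodeMatrix E) i) j
    simp only [Matrix.mul_apply] at h
    simp only [coact_gen, counitHom_gen, map_sum, LinearMap.lTensor_tmul,
      LinearMap.mul'_apply, antipodeLin_gen, h, Matrix.one_apply]
    split_ifs <;> simp
  | halg r =>
    have h1 : antipodeLin E 1 = 1 := by simpa using antipodeLin_algebraMap E 1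
    simp [Algebra.TensorProduct.algebraMap_apply, h1]
  | hadd x y hx hy => simp [hx, hy]
  | hmul x y hx hy =>
    have key : ∀ (t : HopfAlg E ⊗[k] HopfAlg E) (c d : HopfAlg E),
        LinearMap.mul' k _ ((antipodeLin E).lTensor _ (c ⊗ₜ d * t)) =
          c * LinearMap.mul' k _ ((antipodeLin E).lTensor _ t) * antipodeLin E d := by
      intro t c d
      induction t with
      | zero => simp
      | add u v hu hv => simp only [add_mul, mul_add, map_add, hu, hv]
      | tmul a b => simp [antipodeLin_mul, mul_assoc]
    have key2 : ∀ u : HopfAlg E ⊗[k] HopfAlg E,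
        LinearMap.mul' k _ ((antipodeLin E).lTensor _ (u * coact E E y)) =
          LinearMap.mul' k _ ((antipodeLin E).lTensor _ u) * algebraMap k _ (counitHom E y) := by
      intro u
      induction u with
      | zero => simp
      | add u v hu hv => simp only [map_add, add_mul, hu, hv]
      | tmul c d =>
        rw [key, hy, mul_assoc, Algebra.commutes]
        simp [mul_assoc]
    rw [map_mul, key2, hx, map_mul, map_mul]

instance : HopfAlgebra k (HopfAlg E) where
  antipode := antipodeLin E
  mul_antipode_rTensor_comul := LinearMap.ext (antipode_left E)
  mul_antipode_lTensor_comul := LinearMap.ext (antipode_right E)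

end Antipode

/-! ### `B(E, F)` as a left `B(E)`-comodule algebra -/

/-- `B(E, F)` is a left `B(E)`-comodule algebra through `δ(z i j) = ∑ₗ a i l ⊗ z l j`. -/
instance {k : Type*} [CommRing k] {n m : ℕ} (E : GL (Fin n) k) (F : GL (Fin m) k) :
    HopfGalois.LeftComoduleAlgebra k (HopfAlg E) (GalAlg E F) where
  coaction := coact E F
  coassoc := congrArg AlgHom.toLinearMap (coact_coassoc E F)
  counital := congrArg AlgHom.toLinearMap (counit_coact E F)

end QuantumBilinear

end

/-!
Let `H = B(E)` and `Z = B(E, F)`. Once `k` is contained in `Z` as its subalgebra of coinvariants, a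
`k`-linear equivalence `H ≃ Z` of left `H`-comodules already forces `m = n`.

For a left `H`-comodule algebra `Z`, let `P(Z)` be the `k`-module of the vectors `v ∈ Zⁿ` with
`δ(v) = a ⊗ v`, where `a` is the generating matrix of `H`. Suppose that the columns of an invertible
`n × m` matrix `x` over `Z` lie in `P(Z)`. For `v ∈ P(Z)` the entries of `x⁻¹ v` are coinvariant,
because `δ(x⁻¹) (a ⊗ 1) = 1 ⊗ x⁻¹`. So if the coinvariants of `Z` are `k`, then `P(Z)` is free with
the `m` columns of `x` as a basis (`HopfGalois.nonempty_vectors_equiv`). This applies to the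
generating matrix `z` of `B(E, F)`, which is invertible by the defining relations, and gives
`P(Z) ≃ kᵐ`; it also applies to `a` itself, and gives `P(H) ≃ kⁿ`.

If `Z` is cleft, then `H_σ ≃ Z`, and `H_σ` is `H` as a comodule, so that `P(H) ≃ P(Z)`. Hence
`kⁿ ≃ kᵐ`, and `n = m` because `k` is a nontrivial commutative ring.
-/

open TensorProduct Matrix

namespace HopfGalois

section Vectors

variable {k H : Type*} [CommRing k] [Ring H] [HopfAlgebra k H]
  {Z : Type*} [Ring Z] [Algebra k Z] [LeftComoduleAlgebra k H Z]
  {Z' : Type*} [Ring Z'] [Algebra k Z'] [LeftComoduleAlgebra k H Z'] {n m : ℕ}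

/-- The vectors `v ∈ Zⁿ` with `δ(v i) = ∑ₗ a i l ⊗ v l`. When `a` is the coefficient matrix of a
right `H`-comodule structure on `kⁿ`, this is the cotensor product of that comodule with `Z`. -/
def vectors (k : Type*) {H : Type*} [CommRing k] [Ring H] [HopfAlgebra k H] {n : ℕ}
    (Z : Type*) [Ring Z] [Algebra k Z] [LeftComoduleAlgebra k H Z]
    (a : Matrix (Fin n) (Fin n) H) : Submodule k (Fin n → Z) where
  carrier := {v | ∀ i, coaction k H Z (v i) = ∑ l, a i l ⊗ₜ[k] v l}
  add_mem' hv hw i := by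
    simp only [Pi.add_apply, map_add, hv i, hw i, TensorProduct.tmul_add, Finset.sum_add_distrib]
  zero_mem' i := by simp
  smul_mem' r v hv i := by
    simp only [Pi.smul_apply, map_smul, hv i, TensorProduct.tmul_smul, Finset.smul_sum]

theorem mem_vectors {a : Matrix (Fin n) (Fin n) H} {v : Fin n → Z} :
    v ∈ vectors k Z a ↔ ∀ i, coaction k H Z (v i) = ∑ l, a i l ⊗ₜ[k] v l := Iff.rfl

/-- A colinear equivalence `Z ≃ Z'` induces an equivalence between the modules of vectors. -/
def vectorsCongr (a : Matrix (Fin n) (Fin n) H) (ψ : Z ≃ₗ[k] Z')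
    (hψ : ∀ z, coaction k H Z' (ψ z) = ψ.toLinearMap.lTensor H (coaction k H Z z)) :
    vectors k Z a ≃ₗ[k] vectors k Z' a :=
  (LinearEquiv.piCongrRight fun _ : Fin n => ψ).ofSubmodules _ _ <| by
    have hinj : Function.Injective (ψ.toLinearMap.lTensor H) := (ψ.lTensor H).injective
    apply le_antisymm
    · rintro _ ⟨v, hv, rfl⟩ i
      simp [hψ, mem_vectors.1 hv i]
    · intro w hw
      refine ⟨fun i => ψ.symm (w i), fun i => hinj ?_, by ext; simp⟩
      rw [← hψ]
      simpa using mem_vectors.1 hw i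

/-- If `x` is invertible with columns in `vectors k Z a`, then its inverse `y` maps `vectors k Z a`
to vectors with coinvariant entries. -/
theorem mulVec_mem_coinvariants {a : Matrix (Fin n) (Fin n) H} {x : Matrix (Fin n) (Fin m) Z}
    {y : Matrix (Fin m) (Fin n) Z} (hx : ∀ j, (fun i => x i j) ∈ vectors k Z a)
    (hxy : x * y = 1) (hyx : y * x = 1) {v : Fin n → Z} (hv : v ∈ vectors k Z a) (i : Fin m) :
    (y *ᵥ v) i ∈ coinvariants k H Z := by
  set δ := coaction k H Z
  set ι : Z →ₐ[k] H ⊗[k] Z := Algebra.TensorProduct.includeRight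
  set A : Matrix (Fin n) (Fin n) (H ⊗[k] Z) := a.map fun h => h ⊗ₜ[k] (1 : Z)
  have hδx : x.map δ = A * x.map ι := by
    ext i j
    simpa [A, ι, Matrix.mul_apply] using mem_vectors.1 (hx j) i
  have hδv : δ ∘ v = A *ᵥ (ι ∘ v) := by
    ext i
    simpa [A, ι, Matrix.mulVec, dotProduct] using mem_vectors.1 hv i
  have hδy : y.map δ * A = y.map ι := by
    calc y.map δ * A = y.map δ * (A * ((x * y).map ι)) := by
          rw [hxy, Matrix.map_one _ (map_zero ι) (map_one ι), Matrix.mul_one]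
      _ = (y * x).map δ * y.map ι := by
          rw [Matrix.map_mul, Matrix.map_mul, hδx]
          simp only [Matrix.mul_assoc]
      _ = y.map ι := by
          rw [hyx, Matrix.map_one _ (map_zero δ) (map_one δ), Matrix.one_mul]
  have h : δ ((y *ᵥ v) i) = ι ((y *ᵥ v) i) := by
    have h1 : δ ((y *ᵥ v) i) = (y.map δ *ᵥ (δ ∘ v)) i := RingHom.map_mulVec δ.toRingHom y v i
    have h2 : ι ((y *ᵥ v) i) = (y.map ι *ᵥ (ι ∘ v)) i := RingHom.map_mulVec ι.toRingHom y v i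
    rw [h1, h2, hδv, Matrix.mulVec_mulVec, hδy]
  exact h

/-- If the coinvariants of `Z` are `k`, then the columns of an invertible matrix `x` form a basis
of `vectors k Z a` as soon as they lie in it. -/
theorem nonempty_vectors_equiv {a : Matrix (Fin n) (Fin n) H} {x : Matrix (Fin n) (Fin m) Z}
    {y : Matrix (Fin m) (Fin n) Z} (hinj : Function.Injective (algebraMap k Z))
    (hco : coinvariants k H Z = ⊥) (hx : ∀ j, (fun i => x i j) ∈ vectors k Z a)
    (hxy : x * y = 1) (hyx : y * x = 1) : Nonempty ((Fin m → k) ≃ₗ[k] vectors k Z a) := by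
  let f : (Fin m → k) →ₗ[k] vectors k Z a :=
    Fintype.linearCombination k fun j => (⟨fun i => x i j, hx j⟩ : vectors k Z a)
  have hf : ∀ c, (f c : Fin n → Z) = x *ᵥ (algebraMap k Z ∘ c) := by
    intro c
    ext i
    simp [f, Fintype.linearCombination_apply, Matrix.mulVec, dotProduct, Algebra.smul_def,
      Algebra.commutes]
  refine ⟨LinearEquiv.ofBijective f ⟨fun c d hcd => ?_, fun v => ?_⟩⟩
  · have h : x *ᵥ (algebraMap k Z ∘ c) = x *ᵥ (algebraMap k Z ∘ d) := by rw [← hf, ← hf, hcd]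
    have h' := congrArg (y *ᵥ ·) h
    simp only [Matrix.mulVec_mulVec, hyx, Matrix.one_mulVec] at h'
    exact hinj.comp_left h'
  · have h : ∀ i, ∃ r : k, algebraMap k Z r = (y *ᵥ (v : Fin n → Z)) i := fun i =>
      Algebra.mem_bot.1 (hco ▸ mulVec_mem_coinvariants hx hxy hyx v.2 i)
    choose c hc using h
    refine ⟨c, Subtype.ext ?_⟩
    rw [hf, show algebraMap k Z ∘ c = y *ᵥ (v : Fin n → Z) from funext hc,
      Matrix.mulVec_mulVec, hxy, Matrix.one_mulVec]

/-- A comodule algebra isomorphic to `H_σ` is equivalent to `H` as a comodule. -/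
theorem ComoduleAlgebraIso.exists_colinear_equiv [LeftComoduleAlgebra k H H]
    (hH : ∀ x : H, coaction k H H x = Coalgebra.comul (R := k) x) {σ : RightCocycle k H}
    (h : ComoduleAlgebraIso k H (Twist σ) Z) :
    ∃ ψ : H ≃ₗ[k] Z, ∀ x, coaction k H Z (ψ x) =
      ψ.toLinearMap.lTensor H (coaction k H H x) := by
  obtain ⟨φ, hφ⟩ := h
  refine ⟨(toTwist σ).trans φ.toLinearEquiv, fun x => (hφ (toTwist σ x)).trans ?_⟩
  rw [coaction_toTwist, ← LinearMap.comp_apply, ← LinearMap.lTensor_comp, hH]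
  rfl

end Vectors

end HopfGalois

namespace QuantumBilinear

open HopfGalois

variable {k : Type*} [CommRing k] {n m : ℕ} (E : GL (Fin n) k) (F : GL (Fin m) k)

theorem algebraMap_hopfAlg_injective : Function.Injective (algebraMap k (HopfAlg E)) :=
  Function.LeftInverse.injective (g := counitHom E) fun r => (counitHom E).commutes r

theorem coinvariants_hopfAlg : coinvariants k (HopfAlg E) (HopfAlg E) = ⊥ := by
  refine eq_bot_iff.2 fun x hx => Algebra.mem_bot.2 ⟨counitHom E x, ?_⟩
  have hx' : coact E E x = 1 ⊗ₜ[k] x := hx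
  -- apply `id ⊗ ε` to `δ(x) = 1 ⊗ x`
  have h := DFunLike.congr_fun (coact_counit E) x
  rw [AlgHom.comp_apply, hx'] at h
  have h' := congrArg (Algebra.TensorProduct.rid k k (HopfAlg E)) h
  simpa [Algebra.algebraMap_eq_smul_one] using h'

theorem gen_column_mem_vectors (j : Fin m) :
    (fun i => gen E F i j) ∈ vectors k (GalAlg E F) (gen E E) :=
  fun i => coact_gen E F i j

/-- The matrix of generators is invertible, with inverse `F⁻¹ zᵗ E`, so that the vectors over
`B(E, F)` form a free module of rank `m`. -/
theorem nonempty_vectors_galAlg_equiv (hinj : Function.Injective (algebraMap k (GalAlg E F)))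
    (hco : coinvariants k (HopfAlg E) (GalAlg E F) = ⊥) :
    Nonempty ((Fin m → k) ≃ₗ[k] vectors k (GalAlg E F) (gen E E)) :=
  nonempty_vectors_equiv (y := scalarMatrix _ (F⁻¹).val * (gen E F)ᵀ * scalarMatrix _ E.val)
    hinj hco (gen_column_mem_vectors E F)
    (by simpa only [rightWord, Matrix.mul_assoc] using (gen_relations E F).2)
    (gen_relations E F).1

end QuantumBilinear

theorem corollary6 {k : Type*} [CommRing k] [IsDomain k] [IsPrincipalIdealRing k]
    {n m : ℕ} (hn : 2 ≤ n) (hm : 2 ≤ m) (E : GL (Fin n) k) (F : GL (Fin m) k)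
    (h : HopfGalois.IsCleftGaloisObject k (QuantumBilinear.HopfAlg E)
      (QuantumBilinear.GalAlg E F)) :
    m = n := by
  obtain ⟨σ, hσ⟩ := h.cleft
  obtain ⟨ψ, hψ⟩ := hσ.exists_colinear_equiv fun _ => rfl
  obtain ⟨e⟩ :=
    QuantumBilinear.nonempty_vectors_galAlg_equiv E F h.algebraMap_injective h.coinvariants_eq
  obtain ⟨e'⟩ := QuantumBilinear.nonempty_vectors_galAlg_equiv E E
    (QuantumBilinear.algebraMap_hopfAlg_injective E) (QuantumBilinear.coinvariants_hopfAlg E)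
  exact eq_of_fin_equiv k
    (e.trans ((e'.trans (HopfGalois.vectorsCongr (QuantumBilinear.gen E E) ψ hψ)).symm))
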